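/- Let $k$ be a field. For a $k$-algebra $A$ (associative, with unit), an $A$-bimodule is understood to have a central action of $k$, so that it is the same as a left module over the enveloping algebra $A^e = A \otimes_k A^{op}$; the algebra $A$ is called separable if it is projective as a left $A^e$-module. For an $A$-bimodule $X$ put $X^A = \{x \in X : ax = xa \text{ for all } a \in A\}$ and let $H^i(A, X) = \mathrm{Ext}^i_{A^e}(A, X)$ be the Hochschild cohomology vector spaces. Let $E$ be a separable $k$-algebra, $M$ a finitely generated $E$-bimodule, $T = T_E(M) = E \oplus M \oplus (M \otimes_E M) \oplus \cdots$ the tensor algebra, and $X$ a $T$-bimodule which is finitely generated as an $E$-bimodule. Then the vector spaces $H^1(T, X)$, $\mathrm{Hom}_{E-E}(M, X)$ and $X^E / X^T$ are finite dimensional over $k$, and $$\dim_k H^1(T, X) = \dim_k \mathrm{Hom}_{E-E}(M, X) - \dim_k (X^E / X^T),$$ where $\mathrm{Hom}_{E-E}(M, X)$ is the space of $E$-bimodule morphisms from $M$ to $X$. Moreover $H^i(T, X) = 0$ for all $i \geq 2$. -/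

import Mathlib

open scoped TensorProduct

set_option linter.unusedSectionVars false

universe u v w

/-! Bimodules over a `k`-algebra `A` are carried by the type classes `Module A X` (left action) and
`Module Aᵐᵒᵖ X` (right action, `x * a` being `MulOpposite.op a • x`), which commute with each other
and restrict to the same action of `k`. -/

namespace Bimodule

section Basic

variable (k : Type u) (A : Type v) (X : Type w) [Field k] [Ring A] [Algebra k A]
  [AddCommGroup X] [Module k X] [Module A X] [Module Aᵐᵒᵖ X] [SMulCommClass A Aᵐᵒᵖ X]
  [IsScalarTower k A X] [IsScalarTower k Aᵐᵒᵖ X]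

/-- An `A`-bimodule regarded as a left module over the enveloping algebra `A ⊗[k] Aᵐᵒᵖ`, with
`(a ⊗ b) • x = a x b`. -/
def toModuleCat : ModuleCat.{w} (A ⊗[k] Aᵐᵒᵖ) :=
  letI : Module (A ⊗[k] Aᵐᵒᵖ) X := TensorProduct.Algebra.module
  ModuleCat.of (A ⊗[k] Aᵐᵒᵖ) X

theorem tmul_smul (a b : A) (x : X) :
    (a ⊗ₜ[k] MulOpposite.op b) • (show toModuleCat k A X from x) =
      (show toModuleCat k A X from a • MulOpposite.op b • x) := rfl

/-- `X` is finitely generated as an `A`-bimodule. -/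
def IsFinitelyGenerated : Prop := Module.Finite (A ⊗[k] Aᵐᵒᵖ) (toModuleCat k A X)

/-- `X^A`, the elements `x` with `a x = x a` for all `a` in `A`. -/
def invariants : Submodule k X where
  carrier := {x | ∀ a : A, a • x = MulOpposite.op a • x}
  add_mem' hx hy a := by rw [smul_add, smul_add, hx a, hy a]
  zero_mem' a := by rw [smul_zero, smul_zero]
  smul_mem' c x hx a := by
    have h : ∀ y : X, c • y = algebraMap k A c • y := fun y => (algebraMap_smul A c y).symm
    have h' : ∀ y : X, c • y = MulOpposite.op (algebraMap k A c) • y := fun y =>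
      (algebraMap_smul Aᵐᵒᵖ c y).symm
    calc a • c • x = c • a • x := by
          rw [h x, h (a • x), smul_smul, smul_smul, Algebra.commutes c a]
      _ = c • MulOpposite.op a • x := by rw [hx a]
      _ = MulOpposite.op a • c • x := by
          rw [h' x, h' (MulOpposite.op a • x), smul_smul, smul_smul, ← MulOpposite.op_mul,
            ← MulOpposite.op_mul, Algebra.commutes c a]

theorem mem_invariants (x : X) :
    x ∈ invariants k A X ↔ ∀ a : A, a • x = MulOpposite.op a • x := Iff.rfl

end Basic

/-- The `k`-algebra `A` is separable: `A` is projective as a module over its enveloping algebra. -/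
def IsSeparableAlgebra (k : Type u) (A : Type v) [Field k] [Ring A] [Algebra k A] : Prop :=
  Module.Projective (A ⊗[k] Aᵐᵒᵖ) (toModuleCat k A A)

section Hom

variable (k : Type u) (A : Type v) (M X : Type*) [Field k] [Ring A] [Algebra k A]
  [AddCommGroup M] [Module k M] [Module A M] [Module Aᵐᵒᵖ M] [SMulCommClass A Aᵐᵒᵖ M]
  [IsScalarTower k A M] [IsScalarTower k Aᵐᵒᵖ M]
  [AddCommGroup X] [Module k X] [Module A X] [Module Aᵐᵒᵖ X] [SMulCommClass A Aᵐᵒᵖ X]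
  [IsScalarTower k A X] [IsScalarTower k Aᵐᵒᵖ X]

/-- `Hom_{A-A}(M, X)`, the vector space of `A`-bimodule maps. -/
def hom : Submodule k (M →ₗ[k] X) where
  carrier := {f | ∀ (a : A) (m : M),
    f (a • m) = a • f m ∧ f (MulOpposite.op a • m) = MulOpposite.op a • f m}
  add_mem' hf hg a m := by
    simp only [LinearMap.add_apply, smul_add, (hf a m).1, (hg a m).1, (hf a m).2, (hg a m).2,
      and_self]
  zero_mem' a m := by simp only [LinearMap.zero_apply, smul_zero, and_self]
  smul_mem' c f hf a m := by
    have : SMulCommClass k A X := IsScalarTower.to_smulCommClass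
    have : SMulCommClass k Aᵐᵒᵖ X := IsScalarTower.to_smulCommClass
    simp only [LinearMap.smul_apply, (hf a m).1, (hf a m).2, smul_comm c, and_self]

end Hom

/-- The `i`-th Hochschild cohomology vector space `H^i(A, X) = Ext^i(A, X)`, the extensions being
taken over the enveloping algebra of `A`. -/
noncomputable abbrev HochschildCohomology (k A X : Type u) [Field k] [Ring A] [Algebra k A]
    [AddCommGroup X] [Module k X] [Module A X] [Module Aᵐᵒᵖ X] [SMulCommClass A Aᵐᵒᵖ X]
    [IsScalarTower k A X] [IsScalarTower k Aᵐᵒᵖ X] (i : ℕ) : Type u :=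
  CategoryTheory.Abelian.Ext.{u} (toModuleCat k A A) (toModuleCat k A X) i

section Restriction

variable {k : Type u} {A : Type v} {B : Type w} [Field k] [Ring A] [Algebra k A] [Ring B]
  [Algebra k B]

/-- The additive group `X` of a `B`-bimodule, regarded as an `A`-bimodule along a morphism of
`k`-algebras `f : A → B`. -/
def Restrict (_ : A →ₐ[k] B) (X : Type*) : Type _ := X

namespace Restrict

variable (f : A →ₐ[k] B) (X : Type*) [AddCommGroup X] [Module k X] [Module B X] [Module Bᵐᵒᵖ X]
  [SMulCommClass B Bᵐᵒᵖ X] [IsScalarTower k B X] [IsScalarTower k Bᵐᵒᵖ X]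

instance : AddCommGroup (Restrict f X) := inferInstanceAs (AddCommGroup X)

instance : Module k (Restrict f X) := inferInstanceAs (Module k X)

instance : Module A (Restrict f X) := Module.compHom X (f : A →+* B)

instance : Module Aᵐᵒᵖ (Restrict f X) := Module.compHom X (f : A →+* B).op

instance : SMulCommClass A Aᵐᵒᵖ (Restrict f X) :=
  ⟨fun a b x => smul_comm (f a) (MulOpposite.op (f b.unop)) (show X from x)⟩

instance : IsScalarTower k A (Restrict f X) :=
  ⟨fun c a x => by
    change f (c • a) • (show X from x) = c • f a • (show X from x)
    rw [map_smul, smul_assoc]⟩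

instance : IsScalarTower k Aᵐᵒᵖ (Restrict f X) :=
  ⟨fun c a x => by
    change MulOpposite.op (f (c • a.unop)) • (show X from x)
      = c • MulOpposite.op (f a.unop) • (show X from x)
    rw [map_smul, MulOpposite.op_smul, smul_assoc]⟩

/-- The identity map of the underlying vector spaces. -/
def toBase : Restrict f X ≃ₗ[k] X := LinearEquiv.refl k X

theorem toBase_smul (a : A) (x : Restrict f X) : toBase f X (a • x) = f a • toBase f X x := rfl

theorem toBase_op_smul (a : A) (x : Restrict f X) :
    toBase f X (MulOpposite.op a • x) = MulOpposite.op (f a) • toBase f X x := rfl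

end Restrict

variable (f : A →ₐ[k] B) (X : Type*) [AddCommGroup X] [Module k X] [Module B X] [Module Bᵐᵒᵖ X]
  [SMulCommClass B Bᵐᵒᵖ X] [IsScalarTower k B X] [IsScalarTower k Bᵐᵒᵖ X]

theorem invariants_le_invariants_restrict :
    (invariants k B X).comap (Restrict.toBase f X).toLinearMap ≤ invariants k A (Restrict f X) :=
  fun _ hx a => hx (f a)

/-- The quotient vector space `X^A / X^B` of a `B`-bimodule `X`, for a morphism of algebras
`A → B`; note that `X^B` is contained in `X^A`. -/
abbrev InvariantsQuotient : Type _ :=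
  invariants k A (Restrict f X) ⧸
    ((invariants k B X).comap (Restrict.toBase f X).toLinearMap).submoduleOf
      (invariants k A (Restrict f X))

end Restriction

section TensorAlgebra

variable (k : Type u) (E : Type v) (M : Type w) [Field k] [Ring E] [Algebra k E]
  [AddCommGroup M] [Module k M] [Module E M] [Module Eᵐᵒᵖ M] [SMulCommClass E Eᵐᵒᵖ M]
  [IsScalarTower k E M] [IsScalarTower k Eᵐᵒᵖ M]

/-- The relations which turn the tensor algebra of the vector space `E × M` over `k` into the tensor
algebra of the bimodule `M` over `E`: the inclusion of `E` becomes multiplicative and unital, the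
inclusion of `M` becomes a morphism of `E`-bimodules. -/
inductive TensorRel : TensorAlgebra k (E × M) → TensorAlgebra k (E × M) → Prop
  | one : TensorRel (TensorAlgebra.ι k ((1 : E), (0 : M))) 1
  | mul (a b : E) : TensorRel (TensorAlgebra.ι k (a * b, (0 : M)))
      (TensorAlgebra.ι k (a, (0 : M)) * TensorAlgebra.ι k (b, (0 : M)))
  | left (a : E) (m : M) : TensorRel (TensorAlgebra.ι k ((0 : E), a • m))
      (TensorAlgebra.ι k (a, (0 : M)) * TensorAlgebra.ι k ((0 : E), m))
  | right (m : M) (a : E) : TensorRel (TensorAlgebra.ι k ((0 : E), MulOpposite.op a • m))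
      (TensorAlgebra.ι k ((0 : E), m) * TensorAlgebra.ι k (a, (0 : M)))

/-- The tensor algebra `T_E(M)` of the `E`-bimodule `M`, presented by generators and relations; its
universal property is `T.existsUnique_lift` below. -/
def T : Type (max u v w) := RingQuot (TensorRel k E M)

namespace T

noncomputable instance : Ring (T k E M) := inferInstanceAs (Ring (RingQuot (TensorRel k E M)))

noncomputable instance : Algebra k (T k E M) :=
  inferInstanceAs (Algebra k (RingQuot (TensorRel k E M)))

/-- The quotient map from the tensor algebra over `k`. -/
noncomputable def mk : TensorAlgebra k (E × M) →ₐ[k] T k E M :=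
  RingQuot.mkAlgHom k (TensorRel k E M)

variable {k E M} in
theorem mk_eq {x y : TensorAlgebra k (E × M)} (h : TensorRel k E M x y) :
    mk k E M x = mk k E M y :=
  RingQuot.mkAlgHom_rel k h

/-- The inclusion of `E` in degree zero. -/
noncomputable def ofE : E →ₐ[k] T k E M :=
  AlgHom.ofLinearMap
    ((mk k E M).toLinearMap ∘ₗ TensorAlgebra.ι k ∘ₗ LinearMap.inl k E M)
    ((mk_eq TensorRel.one).trans (map_one _))
    (fun a b => (mk_eq (TensorRel.mul a b)).trans (map_mul _ _ _))

/-- The inclusion of `M` in degree one. -/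
noncomputable def ofM : M →ₗ[k] T k E M :=
  (mk k E M).toLinearMap ∘ₗ TensorAlgebra.ι k ∘ₗ LinearMap.inr k E M

variable {k E M} in
theorem ofM_smul (a : E) (m : M) : ofM k E M (a • m) = ofE k E M a * ofM k E M m :=
  (mk_eq (TensorRel.left a m)).trans (map_mul _ _ _)

variable {k E M} in
theorem ofM_op_smul (a : E) (m : M) :
    ofM k E M (MulOpposite.op a • m) = ofM k E M m * ofE k E M a :=
  (mk_eq (TensorRel.right m a)).trans (map_mul _ _ _)

/-- The universal property of the tensor algebra: algebra maps from `T_E(M)` correspond to pairs of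
an algebra map on `E` and an `E`-bimodule map on `M`. -/
theorem existsUnique_lift {A : Type*} [Ring A] [Algebra k A] (f : E →ₐ[k] A) (g : M →ₗ[k] A)
    (hl : ∀ (a : E) (m : M), g (a • m) = f a * g m)
    (hr : ∀ (a : E) (m : M), g (MulOpposite.op a • m) = g m * f a) :
    ∃! φ : T k E M →ₐ[k] A, (∀ a, φ (ofE k E M a) = f a) ∧ ∀ m, φ (ofM k E M m) = g m := by
  let ψ : TensorAlgebra k (E × M) →ₐ[k] A :=
    TensorAlgebra.lift k (LinearMap.coprod f.toLinearMap g)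
  have hψ : ∀ p, ψ (TensorAlgebra.ι k p) = f p.1 + g p.2 := fun p => by
    simp [ψ, LinearMap.coprod_apply]
  have hrel : ∀ ⦃x y⦄, TensorRel k E M x y → ψ x = ψ y := by
    intro x y h
    cases h <;> simp [hψ, hl, hr]
  refine ⟨RingQuot.liftAlgHom k ⟨ψ, hrel⟩, ⟨fun a => ?_, fun m => ?_⟩, ?_⟩
  · refine (RingQuot.liftAlgHom_mkAlgHom_apply k ψ hrel _).trans ?_
    simp [hψ]
  · refine (RingQuot.liftAlgHom_mkAlgHom_apply k ψ hrel _).trans ?_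
    simp [hψ]
  · rintro φ ⟨h1, h2⟩
    refine RingQuot.ringQuot_ext' k _ _ (TensorAlgebra.hom_ext (LinearMap.ext fun p => ?_))
    have e1 : φ (mk k E M (TensorAlgebra.ι k (p.1, 0))) = f p.1 := h1 p.1
    have e2 : φ (mk k E M (TensorAlgebra.ι k (0, p.2))) = g p.2 := h2 p.2
    have e3 : φ (mk k E M (TensorAlgebra.ι k p)) = f p.1 + g p.2 := by
      rw [← e1, ← e2, ← map_add, ← map_add, ← map_add]; simp
    exact e3.trans ((RingQuot.liftAlgHom_mkAlgHom_apply k ψ hrel _).trans (hψ p)).symm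

end T

end TensorAlgebra

end Bimodule

/-! Write `A = T_E(M)`, `Aᵉ = A ⊗ Aᵐᵒᵖ`, and let `Ω` be the kernel of the multiplication `Aᵉ → A`.
Bimodule maps `Ω → X` are the same as derivations `A → X`, so `Ω` is projective as soon as
derivations lift along surjective bimodule maps (`DerivationsLift`). Then `0 → Ω → Aᵉ → A → 0` is a
projective resolution of length one: `H^i(A, X)` vanishes for `i ≥ 2`, and `H^1(A, X)` is
derivations modulo inner derivations.

Separability of `E` enters through an idempotent `∑ x i ⊗ y i`. Averaging with it shows that `E` is
finite dimensional, that every derivation of `E` is inner (`exists_inner_eq`), and that bimodule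
maps lift along surjections (`exists_lift`). By the universal property applied to square-zero
extensions, derivations of `T_E(M)` vanishing on `E` are the same as bimodule maps on `M`. Every
derivation is of this kind up to an inner one, so derivations of `T_E(M)` lift.

The same reduction shows that derivations vanishing on `E` already surject onto `H^1`, and such a
derivation is inner exactly when it comes from an element of `X^E`. This gives the exact sequence `0
→ X^T → X^E → Hom_{E-E}(M, X) → H^1(T, X) → 0`, whence the dimension formula. -/

namespace Bimodule

/-! ### Separability idempotents and finite dimensionality. -/

/-- Data `x i`, `y i` with `∑ x i * y i = 1` such that `∑ x i ⊗ y i` commutes with every element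
of the algebra (a separability idempotent). -/
structure SeparabilityData (k : Type u) (E : Type v) [Field k] [Ring E] [Algebra k E] where
  /-- The number of summands. -/
  n : ℕ
  /-- The left factors. -/
  x : Fin n → E
  /-- The right factors. -/
  y : Fin n → E
  sum_mul : ∑ i, x i * y i = 1
  sum_tmul : ∀ a : E, ∑ i, (a * x i) ⊗ₜ[k] y i = ∑ i, x i ⊗ₜ[k] (y i * a)

/-- Projectivity splits the surjection `r ↦ r • 1` onto `E`, and the idempotent is the image of `1`
under a section `s`. -/
theorem IsSeparableAlgebra.nonempty_separabilityData {k : Type u} {E : Type v} [Field k] [Ring E]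
    [Algebra k E] (hE : IsSeparableAlgebra k E) : Nonempty (SeparabilityData k E) := by
  let : Module (E ⊗[k] Eᵐᵒᵖ) E := TensorProduct.Algebra.module
  have hE' : Module.Projective (E ⊗[k] Eᵐᵒᵖ) E := hE
  let μ : E ⊗[k] Eᵐᵒᵖ →ₗ[k] E := LinearMap.mul' k E ∘ₗ TensorProduct.map LinearMap.id
    (MulOpposite.opLinearEquiv k).symm.toLinearMap
  have hone : ∀ r : E ⊗[k] Eᵐᵒᵖ, r • (1 : E) = μ r := by
    intro r
    induction r with
    | zero => exact (zero_smul (E ⊗[k] Eᵐᵒᵖ) (1 : E)).trans (map_zero μ).symm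
    | tmul a b =>
      change a • b • (1 : E) = a * b.unop
      simp
    | add r s hr hs => rw [add_smul, hr, hs, map_add]
  have hsurj : Function.Surjective (LinearMap.toSpanSingleton (E ⊗[k] Eᵐᵒᵖ) E 1) := by
    intro a
    refine ⟨a ⊗ₜ 1, ?_⟩
    rw [LinearMap.toSpanSingleton_apply, hone]
    simp [μ]
  obtain ⟨s, hs⟩ := Module.projective_lifting_property
    (LinearMap.toSpanSingleton (E ⊗[k] Eᵐᵒᵖ) E 1) LinearMap.id hsurj
  have hse : s 1 • (1 : E) = 1 := LinearMap.congr_fun hs 1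
  -- Both sides are `s a`, because `a` is the result of acting on `1` from either side.
  have hcomm : ∀ a : E, (a ⊗ₜ[k] (1 : Eᵐᵒᵖ)) * s 1 = ((1 : E) ⊗ₜ[k] MulOpposite.op a) * s 1 := by
    intro a
    rw [← smul_eq_mul, ← smul_eq_mul, ← map_smul, ← map_smul, hone, hone]
    simp [μ]
  obtain ⟨n, x, y, hxy⟩ : ∃ (n : ℕ) (x : Fin n → E) (y : Fin n → Eᵐᵒᵖ),
      s 1 = ∑ i, x i ⊗ₜ[k] y i := by
    obtain ⟨S, hS⟩ := TensorProduct.exists_finset (R := k) (s 1)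
    refine ⟨S.card, fun i => (S.equivFin.symm i).1.1, fun i => (S.equivFin.symm i).1.2, ?_⟩
    rw [hS, ← Finset.sum_coe_sort S]
    exact (Equiv.sum_comp S.equivFin.symm (fun p => p.1.1 ⊗ₜ[k] p.1.2)).symm
  refine ⟨⟨n, x, fun i => (y i).unop, ?_, fun a => ?_⟩⟩
  · have h : μ (s 1) = 1 := (hone _).symm.trans hse
    simpa [μ, hxy] using h
  · have h := congrArg (TensorProduct.map (LinearMap.id (R := k) (M := E))
        (MulOpposite.opLinearEquiv k (M := E)).symm.toLinearMap) (hcomm a)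
    simpa [hxy, Finset.mul_sum] using h

namespace SeparabilityData

variable {k : Type u} {E : Type v} [Field k] [Ring E] [Algebra k E] (e : SeparabilityData k E)

/-- Moving `a` across the idempotent inside any bilinear expression is the one computation behind
all the averaging arguments. -/
theorem sum_bilin {V : Type*} [AddCommGroup V] [Module k V] (β : E →ₗ[k] E →ₗ[k] V) (a : E) :
    ∑ i, β (a * e.x i) (e.y i) = ∑ i, β (e.x i) (e.y i * a) := by
  simpa using congrArg (TensorProduct.lift β) (e.sum_tmul a)

-- Every element of `E` lies in the product of the span of the `x i` and the span of the `y i`.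
include e in
theorem finite : Module.Finite k E := by
  let W := Submodule.span k (Set.range e.x)
  let W' := Submodule.span k (Set.range e.y)
  -- A merely `k`-linear projection `p` onto `W` suffices: `∑ p (a * x i) * y i = ∑ p (x i) * (y i *
  -- a) = a`.
  obtain ⟨p, hp⟩ := W.subtype.exists_leftInverse_of_injective (LinearMap.ker_eq_bot.2
    W.injective_subtype)
  have hx : ∀ i, (p (e.x i) : E) = e.x i := fun i =>
    congrArg Subtype.val (LinearMap.congr_fun hp ⟨e.x i, Submodule.subset_span ⟨i, rfl⟩⟩)
  have htop : W * W' = ⊤ := by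
    refine eq_top_iff.2 fun a _ => ?_
    have h := e.sum_bilin ((LinearMap.mul k E).comp (W.subtype.comp p)) a
    have h' : ∑ i, (p (a * e.x i) : E) * e.y i = a := by
      simpa [hx, ← mul_assoc, ← Finset.sum_mul, e.sum_mul] using h
    rw [← h']
    exact Submodule.sum_mem _ fun i _ =>
      Submodule.mul_mem_mul (p _).2 (Submodule.subset_span ⟨i, rfl⟩)
  refine ⟨htop ▸ Submodule.FG.mul ?_ ?_⟩
  · exact Submodule.fg_span (Set.finite_range _)
  · exact Submodule.fg_span (Set.finite_range _)

end SeparabilityData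

/-! ### Derivations and inner derivations with values in a bimodule. -/

section Derivation

variable (k : Type u) (A : Type v) (X : Type w) [Field k] [Ring A] [Algebra k A]
  [AddCommGroup X] [Module k X] [Module A X] [Module Aᵐᵒᵖ X] [SMulCommClass A Aᵐᵒᵖ X]
  [IsScalarTower k A X] [IsScalarTower k Aᵐᵒᵖ X]

/-- The `k`-linear derivations from `A` to the `A`-bimodule `X`. -/
def derivations : Submodule k (A →ₗ[k] X) where
  carrier := {D | ∀ a b : A, D (a * b) = a • D b + MulOpposite.op b • D a}
  add_mem' hf hg a b := by
    simp only [LinearMap.add_apply, hf a b, hg a b, smul_add]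
    abel
  zero_mem' a b := by simp
  smul_mem' c f hf a b := by
    have : SMulCommClass k A X := IsScalarTower.to_smulCommClass
    have : SMulCommClass k Aᵐᵒᵖ X := IsScalarTower.to_smulCommClass
    simp only [LinearMap.smul_apply, hf a b, smul_add, smul_comm c]

variable {k A X}

theorem derivations_map_one {D : A →ₗ[k] X} (hD : D ∈ derivations k A X) : D 1 = 0 := by
  have h := hD 1 1
  simpa using h

variable (k A X)

/-- The inner derivation `a ↦ a x - x a` attached to `x`. -/
def inner : X →ₗ[k] A →ₗ[k] X :=
  have : SMulCommClass k A X := IsScalarTower.to_smulCommClass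
  have : SMulCommClass k Aᵐᵒᵖ X := IsScalarTower.to_smulCommClass
  LinearMap.mk₂ k (fun x a => a • x - MulOpposite.op a • x)
    (fun x y a => by simp only [smul_add]; abel)
    (fun c x a => by simp only [smul_sub, smul_comm c])
    (fun x a b => by simp only [add_smul, MulOpposite.op_add]; abel)
    (fun c x a => by simp only [MulOpposite.op_smul, smul_assoc, smul_sub])

theorem inner_apply (x : X) (a : A) : inner k A X x a = a • x - MulOpposite.op a • x := rfl

theorem inner_mem_derivations (x : X) : inner k A X x ∈ derivations k A X := fun a b => by
  simp only [inner_apply, MulOpposite.op_mul, mul_smul, smul_sub,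
    smul_comm a (MulOpposite.op b)]
  abel

theorem ker_inner : LinearMap.ker (inner k A X) = invariants k A X := by
  ext x
  simp only [LinearMap.mem_ker, LinearMap.ext_iff, inner_apply, mem_invariants, sub_eq_zero,
    LinearMap.zero_apply]

variable {k A X}

theorem SeparabilityData.exists_inner_eq (e : SeparabilityData k A) {D : A →ₗ[k] X}
    (hD : D ∈ derivations k A X) : ∃ x, inner k A X x = D := by
  have : SMulCommClass k A X := IsScalarTower.to_smulCommClass
  -- For `x = ∑ x i D(y i)`, moving `a` across the idempotent gives `a x = ∑ x i D(y i a) = D a + x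
  -- a`.
  refine ⟨∑ i, e.x i • D (e.y i), LinearMap.ext fun a => ?_⟩
  have h := e.sum_bilin (LinearMap.mk₂ k (fun u v => u • D v) (by simp [add_smul]) (by simp)
    (by simp) (fun c u v => by rw [map_smul, smul_comm])) a
  simp only [LinearMap.mk₂_apply, hD _ a, smul_add, Finset.sum_add_distrib, ← mul_smul] at h
  rw [← Finset.sum_smul, e.sum_mul, one_smul] at h
  rw [inner_apply, sub_eq_iff_eq_add, Finset.smul_sum, Finset.smul_sum]
  simpa only [mul_smul, smul_comm _ (MulOpposite.op a)] using h

end Derivation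

/-! ### Lifting bimodule maps over a separable algebra. -/

section Lifting

variable {k : Type u} {E : Type v} {M N P : Type*} [Field k] [Ring E] [Algebra k E]
  [AddCommGroup M] [Module k M] [Module E M] [Module Eᵐᵒᵖ M] [SMulCommClass E Eᵐᵒᵖ M]
  [IsScalarTower k E M] [IsScalarTower k Eᵐᵒᵖ M]
  [AddCommGroup N] [Module k N] [Module E N] [Module Eᵐᵒᵖ N] [SMulCommClass E Eᵐᵒᵖ N]
  [IsScalarTower k E N] [IsScalarTower k Eᵐᵒᵖ N]
  [AddCommGroup P] [Module k P] [Module E P] [Module Eᵐᵒᵖ P] [SMulCommClass E Eᵐᵒᵖ P]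
  [IsScalarTower k E P] [IsScalarTower k Eᵐᵒᵖ P]

/-- Bimodules over a separable algebra are projective. -/
theorem SeparabilityData.exists_lift (e : SeparabilityData k E) {g : N →ₗ[k] P}
    (hg : g ∈ hom k E N P) (hsurj : Function.Surjective g) {θ : M →ₗ[k] P} (hθ : θ ∈ hom k E M P) :
    ∃ θ' ∈ hom k E M N, g ∘ₗ θ' = θ := by
  have : SMulCommClass k E M := IsScalarTower.to_smulCommClass
  have : SMulCommClass k Eᵐᵒᵖ M := IsScalarTower.to_smulCommClass
  have : SMulCommClass k E N := IsScalarTower.to_smulCommClass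
  have : SMulCommClass k Eᵐᵒᵖ N := IsScalarTower.to_smulCommClass
  obtain ⟨f, hf⟩ := Module.projective_lifting_property g θ hsurj
  replace hf : ∀ m, g (f m) = θ m := LinearMap.congr_fun hf
  -- A `k`-linear lift `f` is averaged on the right, `m ↦ ∑ f (m x i) y i`, and afterwards on the
  -- left. Each average is still a lift because `g` and `θ` are bimodule maps and `∑ x i * y i = 1`;
  -- the left average keeps right linearity because the two actions commute.
  obtain ⟨f₁, hf₁, hr⟩ : ∃ f₁ : M →ₗ[k] N, (∀ m, g (f₁ m) = θ m) ∧
      ∀ (a : E) m, f₁ (MulOpposite.op a • m) = MulOpposite.op a • f₁ m := by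
    refine ⟨∑ i, Module.toModuleEnd k (S := Eᵐᵒᵖ) N (MulOpposite.op (e.y i)) ∘ₗ f ∘ₗ
      Module.toModuleEnd k (S := Eᵐᵒᵖ) M (MulOpposite.op (e.x i)), fun m => ?_, fun a m => ?_⟩
    · have h : ∑ i, MulOpposite.op (e.x i * e.y i) = 1 := by
        rw [← MulOpposite.op_one, ← e.sum_mul, Finset.op_sum]
      simp [(hg _ _).2, hf, (hθ _ _).2, ← mul_smul, ← MulOpposite.op_mul, ← Finset.sum_smul, h]
    · have h := e.sum_bilin (LinearMap.mk₂ k (fun u v => MulOpposite.op v • f (MulOpposite.op u • m))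
        (by simp [add_smul])
        (fun c u v => by rw [MulOpposite.op_smul, smul_assoc, map_smul, smul_comm])
        (by simp [add_smul]) (fun c u v => by rw [MulOpposite.op_smul, smul_assoc])) a
      simpa [mul_smul, Finset.smul_sum] using h
  refine ⟨∑ i, Module.toModuleEnd k (S := E) N (e.x i) ∘ₗ f₁ ∘ₗ
      Module.toModuleEnd k (S := E) M (e.y i), fun a m => ⟨?_, ?_⟩, LinearMap.ext fun m => ?_⟩
  · have h := e.sum_bilin (LinearMap.mk₂ k (fun u v => u • f₁ (v • m))
        (by simp [add_smul]) (by simp) (by simp [add_smul])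
        (fun c u v => by rw [smul_assoc, map_smul, smul_comm])) a
    simpa [mul_smul, Finset.smul_sum] using h.symm
  · simp [smul_comm _ (MulOpposite.op a), hr, Finset.smul_sum]
  · simp [(hg _ _).1, hf₁, (hθ _ _).1, ← mul_smul, ← Finset.sum_smul, e.sum_mul]

end Lifting

/-! ### Derivations of the tensor algebra through square-zero extensions. -/

/-- A derivation of `A` in `X` as a section of the square-zero extension of `A` by `X`. -/
def sectionOfDerivation {k : Type u} {A X : Type*} [Field k] [Ring A] [Algebra k A]
    [AddCommGroup X] [Module k X] [Module A X] [Module Aᵐᵒᵖ X] [SMulCommClass A Aᵐᵒᵖ X]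
    [IsScalarTower k A X] [IsScalarTower k Aᵐᵒᵖ X] {D : A →ₗ[k] X} (hD : D ∈ derivations k A X) :
    A →ₐ[k] TrivSqZeroExt A X :=
  AlgHom.ofLinearMap (LinearMap.prod LinearMap.id D : A →ₗ[k] A × X)
    (TrivSqZeroExt.ext rfl (derivations_map_one hD))
    (fun a b => TrivSqZeroExt.ext rfl (hD a b))

section TensorAlgebraDerivations

variable {k : Type u} {E : Type v} {M : Type w} [Field k] [Ring E] [Algebra k E]
  [AddCommGroup M] [Module k M] [Module E M] [Module Eᵐᵒᵖ M] [SMulCommClass E Eᵐᵒᵖ M]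
  [IsScalarTower k E M] [IsScalarTower k Eᵐᵒᵖ M]
  {X : Type*} [AddCommGroup X] [Module k X] [Module (T k E M) X] [Module (T k E M)ᵐᵒᵖ X]
  [SMulCommClass (T k E M) (T k E M)ᵐᵒᵖ X]
  [IsScalarTower k (T k E M) X] [IsScalarTower k (T k E M)ᵐᵒᵖ X]

namespace T

theorem algHom_ext {A : Type*} [Ring A] [Algebra k A] {φ ψ : T k E M →ₐ[k] A}
    (hE : ∀ a, φ (ofE k E M a) = ψ (ofE k E M a)) (hM : ∀ m, φ (ofM k E M m) = ψ (ofM k E M m)) :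
    φ = ψ :=
  (existsUnique_lift k E M (ψ.comp (ofE k E M)) (ψ.toLinearMap ∘ₗ ofM k E M)
    (fun a m => by simp [ofM_smul]) (fun a m => by simp [ofM_op_smul])).unique
    ⟨hE, hM⟩ ⟨fun _ => rfl, fun _ => rfl⟩

/-- The corresponding sections are algebra maps out of `T_E(M)`, hence are determined on `E` and
`M`. -/
theorem derivation_ext {D D' : T k E M →ₗ[k] X} (hD : D ∈ derivations k (T k E M) X)
    (hD' : D' ∈ derivations k (T k E M) X) (hE : ∀ a, D (ofE k E M a) = D' (ofE k E M a))
    (hM : ∀ m, D (ofM k E M m) = D' (ofM k E M m)) : D = D' := by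
  have h : sectionOfDerivation hD = sectionOfDerivation hD' :=
    algHom_ext (fun a => TrivSqZeroExt.ext rfl (hE a)) (fun m => TrivSqZeroExt.ext rfl (hM m))
  exact LinearMap.ext fun t => congrArg TrivSqZeroExt.snd (DFunLike.congr_fun h t)

/-- A bimodule map on `M` extends to a derivation of `T_E(M)` vanishing on `E`. -/
theorem exists_derivation {θ : M →ₗ[k] Restrict (ofE k E M) X}
    (hθ : θ ∈ hom k E M (Restrict (ofE k E M) X)) :
    ∃ D ∈ derivations k (T k E M) X, (∀ a, D (ofE k E M a) = 0) ∧
      ∀ m, D (ofM k E M m) = Restrict.toBase (ofE k E M) X (θ m) := by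
  let θ' : M →ₗ[k] X := (Restrict.toBase (ofE k E M) X).toLinearMap ∘ₗ θ
  have hl : ∀ (a : E) m, θ' (a • m) = ofE k E M a • θ' m := fun a m => (hθ a m).1
  have hr : ∀ (a : E) m, θ' (MulOpposite.op a • m) = MulOpposite.op (ofE k E M a) • θ' m :=
    fun a m => (hθ a m).2
  let g : M →ₗ[k] TrivSqZeroExt (T k E M) X :=
    (LinearMap.prod (ofM k E M) θ' : M →ₗ[k] T k E M × X)
  have hg1 : ∀ m, (g m).fst = ofM k E M m := fun _ => rfl
  have hg2 : ∀ m, (g m).snd = θ' m := fun _ => rfl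
  obtain ⟨φ, ⟨hφE, hφM⟩, -⟩ := existsUnique_lift k E M
    ((TrivSqZeroExt.inlAlgHom k (T k E M) X).comp (ofE k E M)) g
    (fun a m => TrivSqZeroExt.ext (by simp [hg1, ofM_smul]) (by simp [hg2, hl]))
    (fun a m => TrivSqZeroExt.ext (by simp [hg1, ofM_op_smul]) (by simp [hg2, hr]))
  -- Since `φ` is a section of the projection, multiplicativity of `φ` is the Leibniz rule for its
  -- second component.
  have hfst : (TrivSqZeroExt.fstHom k (T k E M) X).comp φ = AlgHom.id k _ :=
    algHom_ext (fun a => by simp [hφE]) (fun m => by simp [hφM, hg1])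
  have hfst' : ∀ t, (φ t).fst = t := DFunLike.congr_fun hfst
  refine ⟨{ toFun t := (φ t).snd, map_add' := by simp, map_smul' := by simp }, fun a b => ?_, fun a => ?_, fun m => ?_⟩
  · simp [hfst']
  · simp [hφE]
  · exact (congrArg TrivSqZeroExt.snd (hφM m)).trans (hg2 m)

theorem restrict_mem_derivations {D : T k E M →ₗ[k] X} (hD : D ∈ derivations k (T k E M) X) :
    (Restrict.toBase (ofE k E M) X).symm.toLinearMap ∘ₗ D ∘ₗ (ofE k E M).toLinearMap ∈
      derivations k E (Restrict (ofE k E M) X) := fun a b => by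
  refine (congrArg D (map_mul (ofE k E M) a b)).trans ((hD _ _).trans ?_)
  rfl

/-- A derivation of `T_E(M)` vanishing on `E` restricts to a bimodule map on `M`. -/
theorem restrict_mem_hom {D : T k E M →ₗ[k] X} (hD : D ∈ derivations k (T k E M) X)
    (hDE : ∀ a, D (ofE k E M a) = 0) :
    (Restrict.toBase (ofE k E M) X).symm.toLinearMap ∘ₗ D ∘ₗ ofM k E M ∈
      hom k E M (Restrict (ofE k E M) X) := fun a m => by
  constructor
  · refine (congrArg D (ofM_smul a m)).trans ((hD _ _).trans ?_)
    rw [hDE, smul_zero, add_zero]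
    rfl
  · refine (congrArg D (ofM_op_smul a m)).trans ((hD _ _).trans ?_)
    rw [hDE, smul_zero, zero_add]
    rfl

/-- The restriction to `E` is inner by separability, and the same element defines an inner
derivation of the whole tensor algebra. -/
theorem exists_sub_inner_vanishing (e : SeparabilityData k E) {D : T k E M →ₗ[k] X}
    (hD : D ∈ derivations k (T k E M) X) :
    ∃ x, ∀ a, (D - inner k (T k E M) X x) (ofE k E M a) = 0 := by
  obtain ⟨x, hx⟩ := e.exists_inner_eq (restrict_mem_derivations hD)
  refine ⟨Restrict.toBase _ _ x, fun a => ?_⟩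
  rw [LinearMap.sub_apply, sub_eq_zero]
  exact (LinearMap.congr_fun hx a).symm

/-- Derivations of `T_E(M)` lift along surjective bimodule maps if `E` is separable. -/
theorem exists_derivation_lift (e : SeparabilityData k E) {N P : Type*}
    [AddCommGroup N] [Module k N] [Module (T k E M) N] [Module (T k E M)ᵐᵒᵖ N]
    [SMulCommClass (T k E M) (T k E M)ᵐᵒᵖ N]
    [IsScalarTower k (T k E M) N] [IsScalarTower k (T k E M)ᵐᵒᵖ N]
    [AddCommGroup P] [Module k P] [Module (T k E M) P] [Module (T k E M)ᵐᵒᵖ P]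
    [SMulCommClass (T k E M) (T k E M)ᵐᵒᵖ P]
    [IsScalarTower k (T k E M) P] [IsScalarTower k (T k E M)ᵐᵒᵖ P]
    {g : N →ₗ[k] P} (hg : g ∈ hom k (T k E M) N P) (hsurj : Function.Surjective g)
    {D : T k E M →ₗ[k] P} (hD : D ∈ derivations k (T k E M) P) :
    ∃ D' ∈ derivations k (T k E M) N, g ∘ₗ D' = D := by
  have hcomp : ∀ {D' : T k E M →ₗ[k] N}, D' ∈ derivations k (T k E M) N →
      g ∘ₗ D' ∈ derivations k (T k E M) P := fun hD' a b => by
    simp [hD' a b, (hg _ _).1, (hg _ _).2]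
  obtain ⟨p, hp⟩ := exists_sub_inner_vanishing e hD
  obtain ⟨n, rfl⟩ := hsurj p
  have hD₁ := sub_mem hD (inner_mem_derivations k (T k E M) P (g n))
  let g' : Restrict (ofE k E M) N →ₗ[k] Restrict (ofE k E M) P :=
    (Restrict.toBase (ofE k E M) P).symm.toLinearMap ∘ₗ g ∘ₗ
      (Restrict.toBase (ofE k E M) N).toLinearMap
  obtain ⟨θ, hθ, hgθ⟩ := e.exists_lift (g := g') (fun a m => hg (ofE k E M a) m) hsurj (restrict_mem_hom hD₁ hp)
  obtain ⟨D₂, hD₂, hD₂E, hD₂M⟩ := exists_derivation hθ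
  refine ⟨D₂ + inner k (T k E M) N n, add_mem hD₂ (inner_mem_derivations k _ N n), ?_⟩
  -- Both derivations vanish on `E` and agree on `M`. The inner part that was removed lifts
  -- separately, as the inner derivation of a preimage `n`.
  have h : g ∘ₗ D₂ = D - inner k (T k E M) P (g n) :=
    derivation_ext (hcomp hD₂) hD₁ (fun a => by rw [hp, LinearMap.comp_apply, hD₂E, map_zero])
      (fun m => (congrArg g (hD₂M m)).trans (LinearMap.congr_fun hgθ m))
  rw [LinearMap.comp_add, h, sub_add_eq_add_sub, sub_eq_iff_eq_add]
  congr 1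
  ext a
  simp [inner_apply, (hg _ _).1, (hg _ _).2]

end T

end TensorAlgebraDerivations

/-! ### The bimodule `Ω` and its universal derivation. -/

section Kernel

variable (k : Type u) (A : Type v) [Field k] [Ring A] [Algebra k A]

/-- The multiplication `a ⊗ b ↦ a b` on the enveloping algebra, a map of left modules. -/
noncomputable def envelopingMul : A ⊗[k] Aᵐᵒᵖ →ₗ[A ⊗[k] Aᵐᵒᵖ] toModuleCat k A A :=
  LinearMap.toSpanSingleton (A ⊗[k] Aᵐᵒᵖ) (toModuleCat k A A) (show A from 1)

theorem envelopingMul_tmul (a : A) (b : Aᵐᵒᵖ) :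
    envelopingMul k A (a ⊗ₜ b) = (show toModuleCat k A A from a * b.unop) := by
  refine (tmul_smul k A A a b.unop 1).trans ?_
  change a • MulOpposite.op b.unop • (1 : A) = a * b.unop
  simp

theorem envelopingMul_surjective : Function.Surjective (envelopingMul k A) := fun a =>
  ⟨(show A from a) ⊗ₜ 1, (envelopingMul_tmul k A _ _).trans (mul_one (show A from a))⟩

/-- The bimodule of noncommutative differential forms of degree one, the kernel of the
multiplication. -/
noncomputable abbrev Omega : Submodule (A ⊗[k] Aᵐᵒᵖ) (A ⊗[k] Aᵐᵒᵖ) :=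
  LinearMap.ker (envelopingMul k A)

/-- The universal derivation `a ↦ 1 ⊗ a - a ⊗ 1`, with values in the enveloping algebra. -/
noncomputable def universalDerivation : A →ₗ[k] A ⊗[k] Aᵐᵒᵖ :=
  (TensorProduct.mk k A Aᵐᵒᵖ 1) ∘ₗ (MulOpposite.opLinearEquiv k).toLinearMap -
    (TensorProduct.mk k A Aᵐᵒᵖ).flip 1

theorem universalDerivation_apply (a : A) :
    universalDerivation k A a = 1 ⊗ₜ MulOpposite.op a - a ⊗ₜ 1 := rfl

theorem universalDerivation_mem (a : A) : universalDerivation k A a ∈ Omega k A := by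
  rw [LinearMap.mem_ker, universalDerivation_apply, map_sub, envelopingMul_tmul,
    envelopingMul_tmul, sub_eq_zero]
  exact (one_mul a).trans (mul_one a).symm

theorem universalDerivation_mul (a b : A) : universalDerivation k A (a * b) =
    a ⊗ₜ 1 * universalDerivation k A b + 1 ⊗ₜ MulOpposite.op b * universalDerivation k A a := by
  simp [universalDerivation_apply, mul_sub]

variable {k A} {X : Type*} [AddCommGroup X] [Module k X] [Module A X] [Module Aᵐᵒᵖ X]
  [SMulCommClass A Aᵐᵒᵖ X] [IsScalarTower k A X] [IsScalarTower k Aᵐᵒᵖ X]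
  [Module (A ⊗[k] Aᵐᵒᵖ) X]

/-- The map `a ⊗ b ↦ a D(b)` on the enveloping algebra. -/
noncomputable def tensorMap (D : A →ₗ[k] X) : A ⊗[k] Aᵐᵒᵖ →ₗ[k] X :=
  have : SMulCommClass k A X := IsScalarTower.to_smulCommClass
  TensorProduct.lift (LinearMap.mk₂ k (fun a b => a • D (MulOpposite.unop b))
    (by simp [add_smul]) (by simp) (by simp) (fun c a b => by simp [smul_comm a]))

theorem tensorMap_tmul (D : A →ₗ[k] X) (a : A) (b : Aᵐᵒᵖ) :
    tensorMap D (a ⊗ₜ b) = a • D b.unop := rfl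

/-- The defect of linearity of `tensorMap D` involves `r` only through its product in `A`, so it
disappears on `Ω`. -/
theorem tensorMap_mul {D : A →ₗ[k] X} (hD : D ∈ derivations k A X) (a b : A) (r : A ⊗[k] Aᵐᵒᵖ) :
    tensorMap D ((a ⊗ₜ MulOpposite.op b) * r) =
      a • MulOpposite.op b • tensorMap D r + a • (show A from envelopingMul k A r) • D b := by
  induction r with
  | zero =>
    rw [mul_zero]
    change tensorMap D 0 = a • MulOpposite.op b • tensorMap D 0 +
      a • (show A from envelopingMul k A 0) • D b
    rw [map_zero, map_zero]
    change 0 = a • MulOpposite.op b • 0 + a • (0 : A) • D b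
    simp
  | tmul c d =>
    rw [envelopingMul_tmul, Algebra.TensorProduct.tmul_mul_tmul, tensorMap_tmul, tensorMap_tmul]
    change (a * c) • D (d.unop * b) = _
    simp only [hD _ _, smul_add, mul_smul, smul_comm c (MulOpposite.op b)]
    rw [add_comm]
  | add r s hr hs =>
    have h : (show A from envelopingMul k A (r + s)) =
      (show A from envelopingMul k A r) + (show A from envelopingMul k A s) := map_add _ r s
    rw [mul_add, map_add, hr, hs, h, map_add, add_smul, smul_add, smul_add, smul_add]
    abel

/-- The map on `Ω` induced by a derivation. -/
noncomputable def omegaMap (hX : ∀ (a b : A) (x : X), (a ⊗ₜ[k] MulOpposite.op b) • x =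
    a • MulOpposite.op b • x) {D : A →ₗ[k] X} (hD : D ∈ derivations k A X) :
    Omega k A →ₗ[A ⊗[k] Aᵐᵒᵖ] X where
  toFun r := tensorMap D r
  map_add' r s := by simp
  map_smul' s r := by
    change tensorMap D (s * r) = s • tensorMap D r
    induction s with
    | zero =>
      refine (congrArg _ (zero_mul (r : A ⊗[k] Aᵐᵒᵖ))).trans ((map_zero _).trans ?_)
      exact (zero_smul (A ⊗[k] Aᵐᵒᵖ) (tensorMap D r)).symm
    | tmul a b =>
      have h : (show A from envelopingMul k A r) = 0 := r.2
      refine (tensorMap_mul hD a b.unop r).trans ?_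
      rw [h, zero_smul, smul_zero, add_zero]
      exact (hX a b.unop _).symm
    | add s t hs ht => rw [add_mul, map_add, hs, ht, add_smul]

theorem omegaMap_universalDerivation (hX : ∀ (a b : A) (x : X), (a ⊗ₜ[k] MulOpposite.op b) • x =
    a • MulOpposite.op b • x) {D : A →ₗ[k] X} (hD : D ∈ derivations k A X) (a : A) :
    omegaMap hX hD ⟨universalDerivation k A a, universalDerivation_mem k A a⟩ = D a := by
  change tensorMap D (universalDerivation k A a) = D a
  rw [universalDerivation_apply, map_sub, tensorMap_tmul, tensorMap_tmul]
  change (1 : A) • D a - a • D 1 = D a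
  rw [derivations_map_one hD, one_smul, smul_zero, sub_zero]

/-- A map on `Ω` is determined by its values on the universal derivation. -/
theorem omega_hom_ext {P : Type*} [AddCommGroup P] [Module (A ⊗[k] Aᵐᵒᵖ) P]
    {f g : Omega k A →ₗ[A ⊗[k] Aᵐᵒᵖ] P}
    (h : ∀ a, f ⟨universalDerivation k A a, universalDerivation_mem k A a⟩ =
      g ⟨universalDerivation k A a, universalDerivation_mem k A a⟩) : f = g := by
  -- Modulo `A ⊗ 1`, the tensor `a ⊗ b` equals `(a ⊗ 1) * (1 ⊗ b - b ⊗ 1)`. Hence `Ω` is generated,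
  -- even as a left `A`-module, by the values of the universal derivation.
  have key : ∀ r : A ⊗[k] Aᵐᵒᵖ,
      ∃ t : Omega k A, r = (t : A ⊗[k] Aᵐᵒᵖ) + (show A from envelopingMul k A r) ⊗ₜ 1 ∧ f t = g t := by
    intro r
    induction r with
    | zero =>
      refine ⟨0, ?_, by rw [map_zero, map_zero]⟩
      exact ((zero_add _).trans (TensorProduct.zero_tmul _ _)).symm
    | tmul a b =>
      refine ⟨(a ⊗ₜ[k] (1 : Aᵐᵒᵖ)) •
        ⟨universalDerivation k A b.unop, universalDerivation_mem k A b.unop⟩, ?_, ?_⟩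
      · rw [envelopingMul_tmul]
        simp [universalDerivation_apply, mul_sub]
      · rw [map_smul, map_smul, h]
    | add r s hr hs =>
      obtain ⟨t, ht, ht'⟩ := hr
      obtain ⟨t', ht₁, ht₁'⟩ := hs
      refine ⟨t + t', ?_, by rw [map_add, map_add, ht', ht₁']⟩
      have h : (show A from envelopingMul k A (r + s)) =
        (show A from envelopingMul k A r) + (show A from envelopingMul k A s) := map_add _ r s
      rw [h, TensorProduct.add_tmul]
      nth_rewrite 1 [ht, ht₁]
      rw [Submodule.coe_add]
      abel
  refine LinearMap.ext fun r => ?_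
  obtain ⟨t, ht, htr⟩ := key r
  have h0 : (show A from envelopingMul k A r) = 0 := r.2
  rw [h0, TensorProduct.zero_tmul, add_zero] at ht
  rwa [Subtype.ext ht]

/-- Composing the universal derivation with a map on `Ω` gives a derivation. -/
theorem exists_derivation_of_omegaMap (hX : ∀ (a b : A) (x : X), (a ⊗ₜ[k] MulOpposite.op b) • x =
    a • MulOpposite.op b • x) (f : Omega k A →ₗ[A ⊗[k] Aᵐᵒᵖ] X) :
    ∃ (D : A →ₗ[k] X) (hD : D ∈ derivations k A X), omegaMap hX hD = f := by
  have hone : ∀ (c : k) (x : X), algebraMap k (A ⊗[k] Aᵐᵒᵖ) c • x = c • x := fun c x => by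
    rw [Algebra.TensorProduct.algebraMap_apply]
    refine (hX _ 1 x).trans ?_
    rw [MulOpposite.op_one, one_smul, algebraMap_smul]
  let u : A →ₗ[k] Omega k A :=
    LinearMap.codRestrict ((Omega k A).restrictScalars k) (universalDerivation k A)
      (universalDerivation_mem k A)
  let D : A →ₗ[k] X :=
    { toFun a := f (u a)
      map_add' a b := by rw [map_add, map_add]
      map_smul' c a := by
        rw [map_smul, ← algebraMap_smul (A ⊗[k] Aᵐᵒᵖ) c (u a), map_smul, hone, RingHom.id_apply] }
  have hD : D ∈ derivations k A X := fun a b => by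
    have h : u (a * b) = (a ⊗ₜ[k] (1 : Aᵐᵒᵖ)) • u b + ((1 : A) ⊗ₜ[k] MulOpposite.op b) • u a :=
      Subtype.ext (universalDerivation_mul k A a b)
    change f (u (a * b)) = a • f (u b) + MulOpposite.op b • f (u a)
    rw [h, map_add, map_smul, map_smul, hX 1 b, one_smul]
    congr 1
    refine (hX a 1 _).trans ?_
    rw [MulOpposite.op_one, one_smul]
  exact ⟨D, hD, omega_hom_ext fun a => omegaMap_universalDerivation hX hD a⟩

end Kernel

/-! ### Lifting of derivations and projectivity of `Ω`. -/

section Projective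

variable (k A : Type u) [Field k] [Ring A] [Algebra k A]

/-- Derivations of `A` lift along surjective bimodule maps. -/
def DerivationsLift : Prop :=
  ∀ (N P : Type u) [AddCommGroup N] [Module k N] [Module A N] [Module Aᵐᵒᵖ N]
    [SMulCommClass A Aᵐᵒᵖ N] [IsScalarTower k A N] [IsScalarTower k Aᵐᵒᵖ N]
    [AddCommGroup P] [Module k P] [Module A P] [Module Aᵐᵒᵖ P]
    [SMulCommClass A Aᵐᵒᵖ P] [IsScalarTower k A P] [IsScalarTower k Aᵐᵒᵖ P]
    (g : N →ₗ[k] P), g ∈ hom k A N P → Function.Surjective g →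
    ∀ D ∈ derivations k A P, ∃ D' ∈ derivations k A N, g ∘ₗ D' = D

variable {k A}

theorem DerivationsLift.exists_omega_lift (H : DerivationsLift k A) {N P : Type u} [AddCommGroup N]
    [AddCommGroup P] [Module (A ⊗[k] Aᵐᵒᵖ) N] [Module (A ⊗[k] Aᵐᵒᵖ) P]
    (g : N →ₗ[A ⊗[k] Aᵐᵒᵖ] P) (hg : Function.Surjective g)
    (f : Omega k A →ₗ[A ⊗[k] Aᵐᵒᵖ] P) :
    ∃ f' : Omega k A →ₗ[A ⊗[k] Aᵐᵒᵖ] N, g ∘ₗ f' = f := by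
  -- Restriction along the two inclusions into the enveloping algebra turns `N` and `P` into
  -- bimodules, to which the hypothesis on derivations applies.
  let i₁ : A →ₐ[k] A ⊗[k] Aᵐᵒᵖ := Algebra.TensorProduct.includeLeft
  let i₂ : Aᵐᵒᵖ →ₐ[k] A ⊗[k] Aᵐᵒᵖ := Algebra.TensorProduct.includeRight
  have h₁₂ : ∀ a b, i₁ a * i₂ b = a ⊗ₜ b := fun a b =>
    (Algebra.TensorProduct.tmul_mul_tmul a 1 1 b).trans (by rw [mul_one, one_mul])
  have h₂₁ : ∀ a b, i₂ b * i₁ a = a ⊗ₜ b := fun a b =>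
    (Algebra.TensorProduct.tmul_mul_tmul 1 a b 1).trans (by rw [mul_one, one_mul])
  let : Module k N := Module.compHom N (algebraMap k (A ⊗[k] Aᵐᵒᵖ))
  let : Module A N := Module.compHom N i₁.toRingHom
  let : Module Aᵐᵒᵖ N := Module.compHom N i₂.toRingHom
  have : SMulCommClass A Aᵐᵒᵖ N := ⟨fun a b x => by
    change i₁ a • i₂ b • x = i₂ b • i₁ a • x
    rw [← mul_smul, ← mul_smul, h₁₂, h₂₁]⟩
  have : IsScalarTower k A N := ⟨fun c a x => by
    change i₁ (c • a) • x = algebraMap k (A ⊗[k] Aᵐᵒᵖ) c • i₁ a • x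
    rw [← mul_smul, ← Algebra.smul_def, map_smul]⟩
  have : IsScalarTower k Aᵐᵒᵖ N := ⟨fun c a x => by
    change i₂ (c • a) • x = algebraMap k (A ⊗[k] Aᵐᵒᵖ) c • i₂ a • x
    rw [← mul_smul, ← Algebra.smul_def, map_smul]⟩
  have hN : ∀ (a b : A) (x : N), (a ⊗ₜ[k] MulOpposite.op b) • x =
      a • MulOpposite.op b • x := fun a b x => by
    change _ = i₁ a • i₂ (MulOpposite.op b) • x
    rw [← mul_smul, h₁₂]
  let : Module k P := Module.compHom P (algebraMap k (A ⊗[k] Aᵐᵒᵖ))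
  let : Module A P := Module.compHom P i₁.toRingHom
  let : Module Aᵐᵒᵖ P := Module.compHom P i₂.toRingHom
  have : SMulCommClass A Aᵐᵒᵖ P := ⟨fun a b x => by
    change i₁ a • i₂ b • x = i₂ b • i₁ a • x
    rw [← mul_smul, ← mul_smul, h₁₂, h₂₁]⟩
  have : IsScalarTower k A P := ⟨fun c a x => by
    change i₁ (c • a) • x = algebraMap k (A ⊗[k] Aᵐᵒᵖ) c • i₁ a • x
    rw [← mul_smul, ← Algebra.smul_def, map_smul]⟩
  have : IsScalarTower k Aᵐᵒᵖ P := ⟨fun c a x => by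
    change i₂ (c • a) • x = algebraMap k (A ⊗[k] Aᵐᵒᵖ) c • i₂ a • x
    rw [← mul_smul, ← Algebra.smul_def, map_smul]⟩
  have hP : ∀ (a b : A) (x : P), (a ⊗ₜ[k] MulOpposite.op b) • x =
      a • MulOpposite.op b • x := fun a b x => by
    change _ = i₁ a • i₂ (MulOpposite.op b) • x
    rw [← mul_smul, h₁₂]
  obtain ⟨D, hD, rfl⟩ := exists_derivation_of_omegaMap hP f
  let g' : N →ₗ[k] P := { toFun := g, map_add' := map_add g, map_smul' c x := map_smul g _ x }
  obtain ⟨D', hD', hgD⟩ := H N P g'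
    (fun a m => ⟨map_smul g (i₁ a) m, map_smul g (i₂ (MulOpposite.op a)) m⟩) hg D hD
  refine ⟨omegaMap hN hD', omega_hom_ext fun a => ?_⟩
  rw [LinearMap.comp_apply, omegaMap_universalDerivation, omegaMap_universalDerivation]
  exact LinearMap.congr_fun hgD a

theorem DerivationsLift.omega_projective (H : DerivationsLift k A) :
    Module.Projective (A ⊗[k] Aᵐᵒᵖ) (Omega k A) :=
  -- It is enough to split surjections from the free module on the set `Ω`, which stays in the
  -- universe over which `DerivationsLift` quantifies.
  Module.Projective.of_lifting_property'' fun f hf =>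
    H.exists_omega_lift (N := Omega k A →₀ A ⊗[k] Aᵐᵒᵖ) (P := Omega k A) f hf LinearMap.id

/-- Derivations of the tensor algebra of a bimodule over a separable algebra lift. -/
theorem SeparabilityData.derivationsLift {k E M : Type u} [Field k] [Ring E] [Algebra k E]
    [AddCommGroup M] [Module k M] [Module E M] [Module Eᵐᵒᵖ M] [SMulCommClass E Eᵐᵒᵖ M]
    [IsScalarTower k E M] [IsScalarTower k Eᵐᵒᵖ M] (e : SeparabilityData k E) :
    DerivationsLift k (T k E M) := by
  intro N P _ _ _ _ _ _ _ _ _ _ _ _ _ _ g hg hsurj D hD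
  exact T.exists_derivation_lift e hg hsurj hD

end Projective

open CategoryTheory Abelian

/-! ### Hochschild cohomology from the presentation by `Ω`. -/

section FirstCohomology

variable (k A : Type u) [Field k] [Ring A] [Algebra k A]

/-- The presentation `0 → Ω → A ⊗ Aᵐᵒᵖ → A → 0` of the regular bimodule. -/
noncomputable def omegaSequence : ShortComplex (ModuleCat.{u} (A ⊗[k] Aᵐᵒᵖ)) where
  X₁ := ModuleCat.of _ (Omega k A)
  X₂ := ModuleCat.of _ (A ⊗[k] Aᵐᵒᵖ)
  X₃ := toModuleCat k A A
  f := ModuleCat.ofHom (Omega k A).subtype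
  g := ModuleCat.ofHom (Y := toModuleCat k A A) (envelopingMul k A)
  zero := by
    ext r
    exact r.2

theorem omegaSequence_shortExact : (omegaSequence k A).ShortExact where
  exact := by
    rw [ShortComplex.ShortExact.moduleCat_exact_iff_function_exact]
    exact fun r => ⟨fun hr => ⟨⟨r, hr⟩, rfl⟩, by rintro ⟨r, rfl⟩; exact r.2⟩
  mono_f := (ModuleCat.mono_iff_injective _).2 (Omega k A).injective_subtype
  epi_g := (ModuleCat.epi_iff_surjective _).2 (envelopingMul_surjective k A)

instance omegaSequence_projective : Projective (omegaSequence k A).X₂ :=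
  ModuleCat.projective_of_categoryTheory_projective (ModuleCat.of (A ⊗[k] Aᵐᵒᵖ) (A ⊗[k] Aᵐᵒᵖ))

variable {k A}

theorem DerivationsLift.projective (H : DerivationsLift k A) :
    Projective (omegaSequence k A).X₁ :=
  have : Module.Projective (A ⊗[k] Aᵐᵒᵖ) (ModuleCat.of (A ⊗[k] Aᵐᵒᵖ) (Omega k A)) :=
    H.omega_projective
  ModuleCat.projective_of_categoryTheory_projective (ModuleCat.of (A ⊗[k] Aᵐᵒᵖ) (Omega k A))

variable (k A) (X : Type u) [AddCommGroup X] [Module k X] [Module A X] [Module Aᵐᵒᵖ X]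
  [SMulCommClass A Aᵐᵒᵖ X] [IsScalarTower k A X] [IsScalarTower k Aᵐᵒᵖ X]

theorem DerivationsLift.subsingleton_hochschildCohomology (H : DerivationsLift k A) {i : ℕ}
    (hi : 2 ≤ i) : Subsingleton (HochschildCohomology k A X i) := by
  obtain ⟨n, rfl⟩ := Nat.exists_eq_add_of_le' hi
  have := H.projective
  refine subsingleton_of_forall_eq 0 fun x => ?_
  -- Dimension shifting: `x` dies on the free middle term, so it comes from `Ext^(n+1)` of the
  -- projective module `Ω`, which is zero since `n + 1 ≥ 1`.
  obtain ⟨y, rfl⟩ := Ext.contravariant_sequence_exact₃ (omegaSequence_shortExact k A) _ x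
    (Ext.eq_zero_of_projective _) (n₀ := n + 1) (by omega)
  rw [Ext.eq_zero_of_projective y]
  exact Ext.comp_zero ..

/-- The morphism out of `Ω` induced by a derivation. -/
noncomputable def omegaHom (D : derivations k A X) :
    (omegaSequence k A).X₁ ⟶ toModuleCat k A X :=
  letI : Module (A ⊗[k] Aᵐᵒᵖ) X := TensorProduct.Algebra.module
  ModuleCat.ofHom (omegaMap (fun a b x => tmul_smul k A X a b x) D.2)

theorem omegaHom_apply (D : derivations k A X) (a : A) :
    (omegaHom k A X D).hom (show Omega k A from
      ⟨universalDerivation k A a, universalDerivation_mem k A a⟩) =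
      (show toModuleCat k A X from D.1 a) :=
  letI : Module (A ⊗[k] Aᵐᵒᵖ) X := TensorProduct.Algebra.module
  omegaMap_universalDerivation (fun a b x => tmul_smul k A X a b x) D.2 a

theorem omegaHom_ext {f g : (omegaSequence k A).X₁ ⟶ toModuleCat k A X}
    (h : ∀ a : A, f.hom (show Omega k A from
      ⟨universalDerivation k A a, universalDerivation_mem k A a⟩) =
      g.hom (show Omega k A from
      ⟨universalDerivation k A a, universalDerivation_mem k A a⟩)) : f = g :=
  ModuleCat.hom_ext (omega_hom_ext h)

theorem omegaHom_surjective : Function.Surjective (omegaHom k A X) := fun f => by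
  let : Module (A ⊗[k] Aᵐᵒᵖ) X := TensorProduct.Algebra.module
  obtain ⟨D, hD, h⟩ := exists_derivation_of_omegaMap (X := X)
    (fun a b x => tmul_smul k A X a b x) f.hom
  exact ⟨⟨D, hD⟩, ModuleCat.hom_ext h⟩

/-- The action of `k` on morphisms and on `Ext` comes through the enveloping algebra; its agreement
with the given action on `X` is what makes `omegaHomLinear` linear. -/
theorem algebraMap_smul_toModuleCat (c : k) (x : X) :
    algebraMap k (A ⊗[k] Aᵐᵒᵖ) c • (show toModuleCat k A X from x) =
      (show toModuleCat k A X from c • x) := by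
  rw [Algebra.TensorProduct.algebraMap_apply]
  refine (tmul_smul k A X _ 1 x).trans ?_
  change algebraMap k A c • MulOpposite.op (1 : A) • x = c • x
  rw [MulOpposite.op_one, one_smul, algebraMap_smul]

/-- The linear map which sends a derivation to the induced morphism out of `Ω`. -/
noncomputable def omegaHomLinear :
    derivations k A X →ₗ[k] ((omegaSequence k A).X₁ ⟶ toModuleCat k A X) where
  toFun := omegaHom k A X
  map_add' D D' := by
    refine omegaHom_ext k A X fun a => ?_
    exact (omegaHom_apply k A X _ a).trans (congrArg₂ (fun x y : toModuleCat k A X => x + y)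
      (omegaHom_apply k A X D a) (omegaHom_apply k A X D' a)).symm
  map_smul' c D := by
    refine omegaHom_ext k A X fun a => ?_
    refine (omegaHom_apply k A X _ a).trans ?_
    refine (algebraMap_smul_toModuleCat k A X c (D.1 a)).symm.trans ?_
    exact congrArg _ (omegaHom_apply k A X D a).symm

/-- The class in `H¹(A, X)` of a derivation. -/
noncomputable def derivationClass : derivations k A X →ₗ[k] HochschildCohomology k A X 1 :=
  Ext.precompOfLinear (omegaSequence_shortExact k A).extClass k (toModuleCat k A X) (add_zero 1) ∘ₗ
    Ext.linearEquiv₀.symm.toLinearMap ∘ₗ omegaHomLinear k A X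

theorem derivationClass_surjective : Function.Surjective (derivationClass k A X) := fun x => by
  obtain ⟨y, rfl⟩ := Ext.contravariant_sequence_exact₃ (omegaSequence_shortExact k A) _ x
    (Ext.eq_zero_of_projective _) (n₀ := 0) (by omega)
  obtain ⟨f, rfl⟩ := Ext.mk₀_bijective _ _ |>.2 y
  obtain ⟨D, rfl⟩ := omegaHom_surjective k A X f
  exact ⟨D, rfl⟩

/-- By the long exact sequence, the class vanishes exactly when the map on `Ω` extends to the
enveloping algebra, and such an extension is given by the image of `1`. -/
theorem derivationClass_eq_zero_iff (D : derivations k A X) :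
    derivationClass k A X D = 0 ↔ ∃ x, inner k A X x = D := by
  -- If `f 1 = x`, then `f (1 ⊗ a - a ⊗ 1) = x a - a x`, which explains the sign in `inner k A X
  -- (-x)`.
  have key : ∀ (f : (omegaSequence k A).X₂ ⟶ toModuleCat k A X) (x : X),
      f.hom (show A ⊗[k] Aᵐᵒᵖ from 1) = x → ∀ a : A, ((omegaSequence k A).f ≫ f).hom
        (show Omega k A from ⟨universalDerivation k A a, universalDerivation_mem k A a⟩) =
          (show toModuleCat k A X from inner k A X (-x) a) := by
    intro f x hx a
    have h : ∀ r : A ⊗[k] Aᵐᵒᵖ, f.hom r = r • (show toModuleCat k A X from x) := fun r => by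
      rw [← hx]
      exact (congrArg f.hom (mul_one r).symm).trans (map_smul f.hom r _)
    refine (h (universalDerivation k A a)).trans ?_
    rw [universalDerivation_apply, sub_smul]
    refine (congrArg₂ _ (tmul_smul k A X 1 a x) (tmul_smul k A X a 1 x)).trans ?_
    change (1 : A) • MulOpposite.op a • x - a • MulOpposite.op (1 : A) • x = _
    rw [inner_apply, one_smul, MulOpposite.op_one, one_smul, smul_neg, smul_neg]
    exact (neg_sub_neg _ _).symm
  constructor
  · intro h
    obtain ⟨y, hy⟩ := Ext.contravariant_sequence_exact₁ (omegaSequence_shortExact k A) _ _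
      (add_zero 1) h
    obtain ⟨f, rfl⟩ := Ext.mk₀_bijective _ _ |>.2 y
    rw [Ext.mk₀_comp_mk₀] at hy
    replace hy := (Ext.mk₀_bijective _ _).1 hy
    refine ⟨-(show X from f.hom (show A ⊗[k] Aᵐᵒᵖ from 1)), LinearMap.ext fun a => ?_⟩
    refine (key f _ rfl a).symm.trans ?_
    rw [hy]
    exact omegaHom_apply k A X D a
  · rintro ⟨x, hx⟩
    let f : (omegaSequence k A).X₂ ⟶ toModuleCat k A X :=
      ModuleCat.ofHom (Y := toModuleCat k A X) (LinearMap.toSpanSingleton (A ⊗[k] Aᵐᵒᵖ)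
        (toModuleCat k A X) (show X from -x))
    have hf : (omegaSequence k A).f ≫ f = omegaHom k A X D := by
      refine omegaHom_ext k A X fun a => ?_
      have h1 : f.hom (show A ⊗[k] Aᵐᵒᵖ from 1) = -x := by
        change (1 : A ⊗[k] Aᵐᵒᵖ) • (show toModuleCat k A X from (-x : X)) = _
        rw [one_smul]
      refine (key f (-x) h1 a).trans ?_
      rw [neg_neg, hx]
      exact (omegaHom_apply k A X D a).symm
    change (omegaSequence_shortExact k A).extClass.comp (Ext.mk₀ (omegaHom k A X D))
      (add_zero 1) = 0
    rw [← hf, ← Ext.mk₀_comp_mk₀]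
    exact (omegaSequence_shortExact k A).extClass_comp_assoc _

variable {k A X}

theorem IsFinitelyGenerated.finite [Module.Finite k A] (h : IsFinitelyGenerated k A X) :
    Module.Finite k X := by
  let : Module (A ⊗[k] Aᵐᵒᵖ) X := TensorProduct.Algebra.module
  have : Module.Finite (A ⊗[k] Aᵐᵒᵖ) X := h
  have : Module.Finite k Aᵐᵒᵖ := Module.Finite.equiv (MulOpposite.opLinearEquiv k)
  have : IsScalarTower k (A ⊗[k] Aᵐᵒᵖ) X :=
    IsScalarTower.of_algebraMap_smul (algebraMap_smul_toModuleCat k A X)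
  exact Module.Finite.trans (A ⊗[k] Aᵐᵒᵖ) X

end FirstCohomology

/-- Rank-nullity for `g`, with the kernel identified with `U ⧸ LinearMap.ker f`. The space `U`
itself may be infinite dimensional, and the equation is in `ℤ` to avoid truncated subtraction. -/
theorem finrank_eq_finrank_sub_finrank_quotient_ker {K U V H : Type*} [Field K]
    [AddCommGroup U] [Module K U] [AddCommGroup V] [Module K V] [AddCommGroup H] [Module K H]
    [Module.Finite K V] (f : U →ₗ[K] V) (g : V →ₗ[K] H) (hfg : LinearMap.range f = LinearMap.ker g)
    (hg : Function.Surjective g) :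
    (Module.finrank K H : ℤ) = Module.finrank K V - Module.finrank K (U ⧸ LinearMap.ker f) := by
  have h := g.finrank_range_add_finrank_ker
  rw [LinearMap.range_eq_top.2 hg, finrank_top, ← hfg] at h
  rw [f.quotKerEquivRange.finrank_eq, ← h]
  push_cast
  ring

/-! ### Derivations of the tensor algebra relative to `E`. -/

section TensorAlgebraCohomology

variable (k : Type u) (E : Type v) (M : Type w) [Field k] [Ring E] [Algebra k E]
  [AddCommGroup M] [Module k M] [Module E M] [Module Eᵐᵒᵖ M] [SMulCommClass E Eᵐᵒᵖ M]
  [IsScalarTower k E M] [IsScalarTower k Eᵐᵒᵖ M]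
  (X : Type*) [AddCommGroup X] [Module k X] [Module (T k E M) X] [Module (T k E M)ᵐᵒᵖ X]
  [SMulCommClass (T k E M) (T k E M)ᵐᵒᵖ X]
  [IsScalarTower k (T k E M) X] [IsScalarTower k (T k E M)ᵐᵒᵖ X]

namespace T

/-- The derivations of `T_E(M)` which vanish on `E`. -/
noncomputable def relativeDerivations : Submodule k (derivations k (T k E M) X) :=
  LinearMap.ker ((LinearMap.lcomp k X (ofE k E M).toLinearMap) ∘ₗ
    (derivations k (T k E M) X).subtype)

theorem mem_relativeDerivations {D : derivations k (T k E M) X} :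
    D ∈ relativeDerivations k E M X ↔ ∀ a, D.1 (ofE k E M a) = 0 :=
  LinearMap.ext_iff

/-- Derivations of `T_E(M)` vanishing on `E` are the same as bimodule maps on `M`. -/
noncomputable def relativeDerivationsEquiv :
    relativeDerivations k E M X ≃ₗ[k] hom k E M (Restrict (ofE k E M) X) :=
  LinearEquiv.ofBijective
    { toFun D := ⟨_, restrict_mem_hom D.1.2 ((mem_relativeDerivations k E M X).1 D.2)⟩
      map_add' _ _ := rfl
      map_smul' _ _ := rfl }
    ⟨fun D D' h => Subtype.ext (Subtype.ext (derivation_ext D.1.2 D'.1.2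
        (fun a => ((mem_relativeDerivations k E M X).1 D.2 a).trans
          ((mem_relativeDerivations k E M X).1 D'.2 a).symm)
        (LinearMap.congr_fun (congrArg Subtype.val h)))),
      fun θ => by
        obtain ⟨D, hD, hDE, hDM⟩ := exists_derivation θ.2
        exact ⟨⟨⟨D, hD⟩, (mem_relativeDerivations k E M X).2 hDE⟩,
          Subtype.ext (LinearMap.ext hDM)⟩⟩

/-- The inner derivations of `T_E(M)` attached to elements commuting with `E`. -/
noncomputable def relativeInner :
    invariants k E (Restrict (ofE k E M) X) →ₗ[k] relativeDerivations k E M X where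
  toFun x := ⟨⟨_, inner_mem_derivations k (T k E M) X (Restrict.toBase (ofE k E M) X x)⟩,
    (mem_relativeDerivations k E M X).2 fun a => sub_eq_zero.2 (x.2 a)⟩
  map_add' x y := by
    ext1; ext1
    exact map_add (inner k (T k E M) X) _ _
  map_smul' c x := by
    ext1; ext1
    exact map_smul (inner k (T k E M) X) _ _

theorem ker_relativeInner : LinearMap.ker (relativeInner k E M X) =
    ((invariants k (T k E M) X).comap (Restrict.toBase (ofE k E M) X).toLinearMap).submoduleOf
      (invariants k E (Restrict (ofE k E M) X)) := by
  ext x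
  rw [LinearMap.mem_ker, Subtype.ext_iff, Subtype.ext_iff]
  have h := SetLike.ext_iff.1 (ker_inner k (T k E M) X) (Restrict.toBase (ofE k E M) X x)
  exact h

end T

end TensorAlgebraCohomology

/-! ### The exact sequence ending in the first cohomology. -/

section RelativeClass

variable (k E M X : Type u) [Field k] [Ring E] [Algebra k E]
  [AddCommGroup M] [Module k M] [Module E M] [Module Eᵐᵒᵖ M] [SMulCommClass E Eᵐᵒᵖ M]
  [IsScalarTower k E M] [IsScalarTower k Eᵐᵒᵖ M]
  [AddCommGroup X] [Module k X] [Module (T k E M) X] [Module (T k E M)ᵐᵒᵖ X]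
  [SMulCommClass (T k E M) (T k E M)ᵐᵒᵖ X]
  [IsScalarTower k (T k E M) X] [IsScalarTower k (T k E M)ᵐᵒᵖ X]

namespace T

/-- The class in `H¹(T_E(M), X)` of a derivation vanishing on `E`. -/
noncomputable def relativeClass :
    relativeDerivations k E M X →ₗ[k] HochschildCohomology k (T k E M) X 1 :=
  derivationClass k (T k E M) X ∘ₗ (relativeDerivations k E M X).subtype

/-- Subtracting an inner derivation does not change the class, and some such subtraction makes the
derivation vanish on `E`. -/
theorem relativeClass_surjective (e : SeparabilityData k E) :
    Function.Surjective (relativeClass k E M X) := fun c => by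
  obtain ⟨D, rfl⟩ := derivationClass_surjective k (T k E M) X c
  obtain ⟨x, hx⟩ := exists_sub_inner_vanishing e D.2
  let I : derivations k (T k E M) X := ⟨_, inner_mem_derivations k (T k E M) X x⟩
  refine ⟨⟨D - I, (mem_relativeDerivations k E M X).2 hx⟩, ?_⟩
  change derivationClass k (T k E M) X (D - I) = _
  rw [map_sub, (derivationClass_eq_zero_iff k (T k E M) X I).2 ⟨x, rfl⟩, sub_zero]

theorem range_relativeInner :
    LinearMap.range (relativeInner k E M X) = LinearMap.ker (relativeClass k E M X) := by
  ext D
  rw [LinearMap.mem_ker]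
  refine Iff.trans ?_ (derivationClass_eq_zero_iff k (T k E M) X D.1).symm
  constructor
  · rintro ⟨x, rfl⟩
    exact ⟨_, rfl⟩
  -- An inner derivation attached to `x` vanishes on `E` only if `x` commutes with `E`.
  · rintro ⟨x, hx⟩
    refine ⟨⟨(Restrict.toBase (ofE k E M) X).symm x, fun a => sub_eq_zero.1 ?_⟩,
      Subtype.ext (Subtype.ext hx)⟩
    exact (LinearMap.congr_fun hx (ofE k E M a)).trans
      ((mem_relativeDerivations k E M X).1 D.2 a)

end T

end RelativeClass

end Bimodule

theorem theorem4p4 (k E M X : Type u) [Field k] [Ring E] [Algebra k E]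
    [AddCommGroup M] [Module k M] [Module E M] [Module Eᵐᵒᵖ M] [SMulCommClass E Eᵐᵒᵖ M]
    [IsScalarTower k E M] [IsScalarTower k Eᵐᵒᵖ M]
    [AddCommGroup X] [Module k X] [Module (Bimodule.T k E M) X] [Module (Bimodule.T k E M)ᵐᵒᵖ X]
    [SMulCommClass (Bimodule.T k E M) (Bimodule.T k E M)ᵐᵒᵖ X]
    [IsScalarTower k (Bimodule.T k E M) X] [IsScalarTower k (Bimodule.T k E M)ᵐᵒᵖ X]
    (hE : Bimodule.IsSeparableAlgebra k E)
    (hM : Bimodule.IsFinitelyGenerated k E M)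
    (hX : Bimodule.IsFinitelyGenerated k E (Bimodule.Restrict (Bimodule.T.ofE k E M) X)) :
    Module.Finite k (Bimodule.HochschildCohomology k (Bimodule.T k E M) X 1) ∧
    Module.Finite k (Bimodule.hom k E M (Bimodule.Restrict (Bimodule.T.ofE k E M) X)) ∧
    Module.Finite k (Bimodule.InvariantsQuotient (Bimodule.T.ofE k E M) X) ∧
    (Module.finrank k (Bimodule.HochschildCohomology k (Bimodule.T k E M) X 1) : ℤ) =
      Module.finrank k (Bimodule.hom k E M (Bimodule.Restrict (Bimodule.T.ofE k E M) X)) -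
        Module.finrank k (Bimodule.InvariantsQuotient (Bimodule.T.ofE k E M) X) ∧
    ∀ i : ℕ, 2 ≤ i →
      Subsingleton (Bimodule.HochschildCohomology k (Bimodule.T k E M) X i) := by
  obtain ⟨e⟩ := hE.nonempty_separabilityData
  have := e.finite
  have := hM.finite
  have := hX.finite
  -- With `E` finite dimensional, the finitely generated bimodules `M` and `X` are finite
  -- dimensional over `k`, hence so is the space of linear maps between them.
  have hhom : Module.Finite k
    (Bimodule.hom k E M (Bimodule.Restrict (Bimodule.T.ofE k E M) X)) := inferInstance
  have hrel : Module.Finite k (Bimodule.T.relativeDerivations k E M X) :=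
    Module.Finite.equiv (Bimodule.T.relativeDerivationsEquiv k E M X).symm
  have hsurj := Bimodule.T.relativeClass_surjective k E M X e
  refine ⟨Module.Finite.of_surjective _ hsurj, hhom, inferInstance, ?_,
    fun i hi => e.derivationsLift.subsingleton_hochschildCohomology k _ X hi⟩
  have h := Bimodule.finrank_eq_finrank_sub_finrank_quotient_ker
    (U := Bimodule.invariants k E (Bimodule.Restrict (Bimodule.T.ofE k E M) X))
    (V := Bimodule.T.relativeDerivations k E M X)
    (H := Bimodule.HochschildCohomology k (Bimodule.T k E M) X 1)
    (Bimodule.T.relativeInner k E M X) (Bimodule.T.relativeClass k E M X)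
    (Bimodule.T.range_relativeInner k E M X) hsurj
  rwa [(Bimodule.T.relativeDerivationsEquiv k E M X).finrank_eq,
    Bimodule.T.ker_relativeInner] at h
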